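/- A field $K$ is called ample (or large) if every smooth curve $C$ over $K$ that has a $K$-rational point has infinitely many $K$-rational points; here a curve over $K$ is a one-dimensional variety over $K$, and varieties are geometrically irreducible and geometrically reduced. A subset $X\subseteq K$ is called existentially $K$-definable if there is an existential first-order formula $\varphi(x)$ in the language of rings, in one free variable $x$ and with parameters from $K$, such that $X$ is the set of all $a\in K$ for which $\varphi(a)$ holds in $K$. Let $K$ be a perfect ample field. Then no infinite proper subfield $F\subsetneq K$ is existentially $K$-definable. -/

import Mathlib

open CategoryTheory AlgebraicGeometry
open scoped FirstOrder

universe u v w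

/-- `f : C ⟶ Spec K` exhibits `C` as a smooth curve over the field `K`: a geometrically integral
(that is, geometrically irreducible and geometrically reduced), separated scheme of finite type
over `K` that is smooth of relative dimension `1`. Local finiteness of type is part of smoothness;
together with quasi-compactness this is finiteness of type. -/
structure IsSmoothCurve (K : Type u) [Field K] {C : Scheme.{u}} (f : C ⟶ Spec (.of K)) :
    Prop where
  isSeparated : IsSeparated f
  quasiCompact : QuasiCompact f
  geometricallyIntegral : GeometricallyIntegral f
  smooth : SmoothOfRelativeDimension 1 f

/-- The `K`-rational points of a `K`-scheme: the sections of its structure morphism. -/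
abbrev RationalPoint (K : Type u) [Field K] {C : Scheme.{u}} (f : C ⟶ Spec (.of K)) : Type u :=
  {s : Spec (.of K) ⟶ C // s ≫ f = 𝟙 (Spec (.of K))}

/-- A field `K` is ample (or large) if every smooth curve over `K` that has a `K`-rational point
has infinitely many of them. -/
def IsAmpleField (K : Type u) [Field K] : Prop :=
  ∀ (C : Scheme.{u}) (f : C ⟶ Spec (.of K)), IsSmoothCurve K f →
    Nonempty (RationalPoint K f) → Infinite (RationalPoint K f)

/-- A subset `X` of a structure `M` is existentially `A`-definable if it is the set of elements
of `M` that satisfy some existential formula in one free variable with parameters from `A`. -/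
def ExistentiallyDefinable₁ (L : FirstOrder.Language.{u, v}) {M : Type w} [L.Structure M] (A X : Set M) :
    Prop :=
  ∃ φ : L[[A]].Formula (Fin 1), φ.IsExistential ∧ X = {x : M | φ.Realize fun _ => x}

/-!
Let `x` be an étale coordinate on `Spec A` and `P` a rational point. For `c ≠ 0` the function
`P x + c (x - P x)` is another étale coordinate with the same value at `P`, so the fibre product of
the two over the affine line contains, near the point `(P, P)`, a smooth curve. If `K` is ample, the
two coordinates therefore have infinitely many common values, which is impossible when the values
of `x` lie in a subfield that misses `c`. Hence the values of an étale coordinate generate `K`, and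
so do those of a smooth one, restricted to an étale slice.

Now let `x` be a transcendental function on an affine variety over a perfect field `K` whose
rational points are dense. If `x` is not a `p`-th power in the function field, where `p` is the
characteristic, it is a smooth coordinate on a nonempty open subset. In general
`x = z ^ (p ^ n)` for such a `z`: each extracted root enlarges the field that it generates with the
rest of a transcendence basis, and so lowers the degree of the function field over that field. Since
`K` is perfect, an iterate of Frobenius is an automorphism of `K`, and it carries the values of `z`
to values of `x`.

An infinite existentially definable set is the image of a constructible set under a coordinate
function. Among the closed sets on which this coordinate still takes infinitely many values at
points of the constructible set, a minimal one is an irreducible variety with dense rational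
points, and the constructible set contains all the rational points of a nonempty open part of it.
-/

open Polynomial TensorProduct

theorem isDomain_of_prime_of_finiteMultiplicity {R : Type*} [CommRing R] {t : R} (ht : Prime t)
    (hreg : IsSMulRegular R t) (hfin : ∀ x ≠ 0, FiniteMultiplicity t x) : IsDomain R := by
  have : Nontrivial R := ⟨t, 0, ht.ne_zero⟩
  have : NoZeroDivisors R := by
    refine ⟨fun {a b} hab ↦ ?_⟩
    by_contra! h
    obtain ⟨y, hay, hy⟩ := (hfin a h.1).exists_eq_pow_mul_and_not_dvd
    obtain ⟨z, hbz, hz⟩ := (hfin b h.2).exists_eq_pow_mul_and_not_dvd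
    have hyz : y * z = 0 := by
      refine (hreg.pow (multiplicity t a + multiplicity t b)).right_eq_zero_of_smul ?_
      rw [smul_eq_mul, pow_add, mul_mul_mul_comm, ← hay, ← hbz, hab]
    exact (ht.dvd_or_dvd (hyz ▸ dvd_zero t)).elim hy hz
  exact NoZeroDivisors.to_isDomain R

theorem isDomain_tensorProduct_of_ker_eq_span {K R L : Type*} [Field K] [CommRing R] [Algebra K R]
    [CommRing L] [IsDomain L] [Algebra K L] (P : R →ₐ[K] K) {t : R}
    (hP : RingHom.ker P = Ideal.span {t}) (hreg : IsSMulRegular R t)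
    (hfin : ∀ x ≠ 0, FiniteMultiplicity t x) : IsDomain (R ⊗[K] L) := by
  have hreg' : IsSMulRegular (R ⊗[K] L) (t ⊗ₜ[K] (1 : L)) := hreg.of_flat (S := R ⊗[K] L)
  let PL := Algebra.TensorProduct.map P (AlgHom.id K L)
  have hker : Ideal.span {t ⊗ₜ[K] (1 : L)} = RingHom.ker PL := by
    rw [Algebra.TensorProduct.rTensor_ker _ fun y ↦ ⟨algebraMap K R y, P.commutes y⟩, hP,
      Ideal.map_span, Set.image_singleton]
    rfl
  have : IsDomain (K ⊗[K] L) := (Algebra.TensorProduct.lid K L).toMulEquiv.isDomain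
  have : Nontrivial (R ⊗[K] L) := PL.toRingHom.domain_nontrivial
  have hne : t ⊗ₜ[K] (1 : L) ≠ 0 := fun h ↦
    not_subsingleton (R ⊗[K] L) (h ▸ hreg').subsingleton
  refine isDomain_of_prime_of_finiteMultiplicity
    ((Ideal.span_singleton_prime hne).mp (hker ▸ RingHom.ker_isPrime _)) hreg'
    fun x hx ↦ ?_
  let b := (Module.Basis.ofVectorSpace K L).baseChange R
  obtain ⟨i, hi⟩ : ∃ i, b.repr x i ≠ 0 := by
    by_contra! h
    exact hx (b.repr.injective (by ext i; simpa using h i))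
  obtain ⟨n, hn⟩ := hfin _ hi
  refine ⟨n, fun ⟨y, hy⟩ ↦ hn ⟨b.repr y i, ?_⟩⟩
  have : x = t ^ (n + 1) • y := by
    rw [hy, Algebra.TensorProduct.tmul_pow, one_pow, Algebra.smul_def]
    rfl
  simp [this]

theorem finiteMultiplicity_of_mem_maximalIdeal {R : Type*} [CommRing R] [IsLocalRing R]
    [IsNoetherianRing R] {t x : R} (ht : t ∈ IsLocalRing.maximalIdeal R) (hx : x ≠ 0) :
    FiniteMultiplicity t x := by
  by_contra h
  have hKrull := Ideal.iInf_pow_eq_bot_of_isLocalRing (Ideal.span {t})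
    (ne_top_of_le_ne_top Ideal.IsPrime.ne_top'
      ((Ideal.span_singleton_le_iff_mem (IsLocalRing.maximalIdeal R)).mpr ht))
  refine hx (Ideal.mem_bot.mp (hKrull ▸ Ideal.mem_iInf.mpr fun n ↦ ?_))
  rw [Ideal.span_singleton_pow, Ideal.mem_span_singleton]
  exact FiniteMultiplicity.not_iff_forall.mp h n

theorem exists_away_algHom_atPrime_injective {A : Type*} [CommRing A] [IsNoetherianRing A]
    (p : Ideal A) [p.IsPrime] :
    ∃ f ∉ p, ∃ g : Localization.Away f →ₐ[A] Localization.AtPrime p, Function.Injective g := by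
  let k := RingHom.ker (algebraMap A (Localization.AtPrime p))
  obtain ⟨⟨f, hf⟩, hfk⟩ := Module.Finite.exists_smul_of_comp_eq_of_isLocalizedModule p.primeCompl
    (Algebra.linearMap A (Localization.AtPrime p)) k.subtype 0
      (by ext x; simpa using RingHom.mem_ker.mp x.2)
  have hker (a : A) (ha : a ∈ k) : f * a = 0 := by
    simpa [Submonoid.smul_def] using congr($hfk ⟨a, ha⟩)
  let g : Localization.Away f →ₐ[A] Localization.AtPrime p :=
    IsLocalization.Away.liftAlgHom f (f := Algebra.ofId A _)
      (IsLocalization.map_units (M := p.primeCompl) _ ⟨f, hf⟩)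
  refine ⟨f, hf, g, (injective_iff_map_eq_zero g).mpr fun x hx ↦ ?_⟩
  obtain ⟨⟨a, s⟩, has⟩ := IsLocalization.surj (Submonoid.powers f) x
  have ha : a ∈ k := by
    rw [RingHom.mem_ker, ← g.commutes, ← has, map_mul, hx, zero_mul]
  have ha' : algebraMap A (Localization.Away f) a = 0 :=
    (IsLocalization.map_eq_zero_iff (Submonoid.powers f) _ _).mpr
      ⟨⟨f, Submonoid.mem_powers f⟩, hker a ha⟩
  exact (IsLocalization.map_units _ s).mul_left_eq_zero.mp (has.trans ha')

/-- The function `x` on `Spec A` is an étale coordinate over `K`: it defines an étale morphism from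
`Spec A` to the affine line. -/
def IsEtaleCoordinate (K : Type*) {A : Type*} [CommRing K] [CommRing A] [Algebra K A] (x : A) :
    Prop :=
  (aeval x : K[X] →ₐ[K] A).toRingHom.Etale

namespace IsEtaleCoordinate

section LocalRing

variable {K A : Type*} [Field K] [CommRing A] [Algebra K A] {x : A}

theorem finiteType (hx : IsEtaleCoordinate K x) : Algebra.FiniteType K A := by
  algebraize [(aeval x : K[X] →ₐ[K] A).toRingHom]
  have : Algebra.Etale K[X] A := hx
  have : IsScalarTower K K[X] A := .of_algebraMap_eq' (aeval x).comp_algebraMap.symm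
  exact .trans (S := K[X]) inferInstance inferInstance

theorem maximalIdeal_localization (hx : IsEtaleCoordinate K x) (P : A →ₐ[K] K)
    [(RingHom.ker P).IsPrime] :
    IsLocalRing.maximalIdeal (Localization.AtPrime (RingHom.ker P)) =
      Ideal.span {algebraMap A (Localization.AtPrime (RingHom.ker P))
        (x - algebraMap K A (P x))} := by
  algebraize [(aeval x : K[X] →ₐ[K] A).toRingHom]
  have : Algebra.Etale K[X] A := hx
  let := Localization.AtPrime.algebraOfLiesOver ((RingHom.ker P).under K[X]) (RingHom.ker P)
  have : Algebra.IsUnramifiedAt K[X] (RingHom.ker P) := Algebra.FormallyUnramified.comp _ A _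
  have hunder : (RingHom.ker P).under K[X] = Ideal.span {X - C (P x)} := by
    rw [← Polynomial.ker_evalRingHom]
    ext f
    have heval : P (aeval x f) = eval (P x) f := by
      rw [← aeval_algHom_apply, coe_aeval_eq_eval]
    exact Eq.congr_left heval
  have hmap : algebraMap K[X] A (X - C (P x)) = x - algebraMap K A (P x) := by
    simp [RingHom.algebraMap_toAlgebra]
  rw [← ((Algebra.isUnramifiedAt_iff_map_eq K[X] ((RingHom.ker P).under K[X])
    (RingHom.ker P)).mp inferInstance).2, hunder, Ideal.map_span, Set.image_singleton,
    IsScalarTower.algebraMap_apply K[X] A, hmap]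

theorem isDomain_localization_tensorProduct (hx : IsEtaleCoordinate K x) (P : A →ₐ[K] K)
    [(RingHom.ker P).IsPrime] (L : Type*) [CommRing L] [IsDomain L] [Algebra K L] :
    IsDomain (Localization.AtPrime (RingHom.ker P) ⊗[K] L) := by
  have := hx.finiteType
  have := Algebra.FiniteType.isNoetherianRing K A
  have := IsLocalization.isNoetherianRing (RingHom.ker P).primeCompl
    (Localization.AtPrime (RingHom.ker P)) this
  let P' : Localization.AtPrime (RingHom.ker P) →ₐ[K] K :=
    IsLocalization.liftAlgHom (M := (RingHom.ker P).primeCompl) (f := P) fun y ↦ IsUnit.mk0 _ y.2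
  have hmax := hx.maximalIdeal_localization P
  have hker : RingHom.ker P' = IsLocalRing.maximalIdeal _ :=
    IsLocalRing.eq_maximalIdeal (RingHom.ker_isMaximal_of_surjective _ fun y ↦
      ⟨algebraMap K _ y, P'.commutes y⟩)
  refine isDomain_tensorProduct_of_ker_eq_span P' (hker.trans hmax) ?_ fun y hy ↦ ?_
  · algebraize [(aeval x : K[X] →ₐ[K] A).toRingHom]
    have : Algebra.Etale K[X] A := hx
    have : Module.Flat A (Localization.AtPrime (RingHom.ker P)) :=
      IsLocalization.flat _ (RingHom.ker P).primeCompl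
    have : Module.Flat K[X] (Localization.AtPrime (RingHom.ker P)) := .trans K[X] A _
    have hreg := (IsRegular.of_ne_zero (X_sub_C_ne_zero (P x))).left.isSMulRegular.of_flat
      (S := Localization.AtPrime (RingHom.ker P))
    simpa [IsScalarTower.algebraMap_apply K[X] A, RingHom.algebraMap_toAlgebra (aeval x).toRingHom]
      using hreg
  · refine finiteMultiplicity_of_mem_maximalIdeal ?_ hy
    exact hmax ▸ Ideal.mem_span_singleton_self _

end LocalRing

end IsEtaleCoordinate

section SmoothCurve

theorem isStandardSmoothOfRelativeDimension_one_polynomial (R : Type*) [CommRing R] [Nontrivial R] :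
    Algebra.IsStandardSmoothOfRelativeDimension 1 R R[X] := by
  let b : Module.Basis Unit R[X] (Ω[R[X]⁄R]) :=
    (Module.Basis.singleton Unit R[X]).map (KaehlerDifferential.polynomialEquiv R).symm
  have : Algebra.IsStandardSmooth R R[X] := by
    refine .of_basis_kaehlerDifferential b ?_
    rintro _ ⟨i, rfl⟩
    exact ⟨X, by simp [b]⟩
  rw [Algebra.IsStandardSmoothOfRelativeDimension.iff_of_isStandardSmooth, rank_eq_card_basis b]
  simp

variable {K A : Type u} [Field K] [CommRing A] [Algebra K A]

theorem geometricallyIntegral_Spec_map_algebraMap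
    (h : ∀ (L : Type u) [Field L] [Algebra K L], IsDomain (A ⊗[K] L)) :
    GeometricallyIntegral (Spec.map (CommRingCat.ofHom (algebraMap K A))) := by
  rw [geometricallyIntegral_iff, geometrically_iff_of_commRing]
  intro L _ _ Y fst snd hY
  have := h L
  let e : Y ≅ Spec (CommRingCat.of (A ⊗[K] L)) := hY.isoPullback ≪≫ pullbackSpecIso K A L
  have : Nonempty Y := ⟨e.inv (Classical.arbitrary (Spec (CommRingCat.of (A ⊗[K] L))))⟩
  exact isIntegral_of_isOpenImmersion e.hom

theorem IsEtaleCoordinate.isStandardSmoothOfRelativeDimension_one {x : A}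
    (hx : IsEtaleCoordinate K x) : Algebra.IsStandardSmoothOfRelativeDimension 1 K A := by
  algebraize [(aeval x : K[X] →ₐ[K] A).toRingHom]
  have : Algebra.Etale K[X] A := hx
  have : IsScalarTower K K[X] A := .of_algebraMap_eq' (aeval x).comp_algebraMap.symm
  have := isStandardSmoothOfRelativeDimension_one_polynomial K
  have : Algebra.IsStandardSmoothOfRelativeDimension 0 K[X] A :=
    Algebra.Etale.iff_isStandardSmoothOfRelativeDimension_zero.mp inferInstance
  exact .trans 1 0 K K[X] A

theorem IsEtaleCoordinate.isSmoothCurve {x : A} (hx : IsEtaleCoordinate K x)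
    (hA : ∀ (L : Type u) [Field L] [Algebra K L], IsDomain (A ⊗[K] L)) :
    IsSmoothCurve K (Spec.map (CommRingCat.ofHom (algebraMap K A))) where
  isSeparated := inferInstance
  quasiCompact := inferInstance
  geometricallyIntegral := geometricallyIntegral_Spec_map_algebraMap hA
  smooth := by
    rw [HasRingHomProperty.Spec_iff (P := @SmoothOfRelativeDimension 1)]
    refine RingHom.locally_of RingHom.isStandardSmoothOfRelativeDimension_respectsIso _ ?_
    simpa [RingHom.isStandardSmoothOfRelativeDimension_algebraMap] using
      hx.isStandardSmoothOfRelativeDimension_one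

/-- The correspondence between the rational points of `Spec A` and the `K`-algebra homomorphisms
`A → K`. -/
noncomputable def rationalPointEquiv (K A : Type u) [Field K] [CommRing A] [Algebra K A] :
    RationalPoint K (Spec.map (CommRingCat.ofHom (algebraMap K A))) ≃ (A →ₐ[K] K) where
  toFun s :=
    { (Spec.preimage s.1).hom with
      commutes' := fun c ↦ by
        have h : CommRingCat.ofHom (algebraMap K A) ≫ Spec.preimage s.1 = 𝟙 _ := by
          apply Spec.map_injective
          rw [Spec.map_comp, Spec.map_preimage, s.2, Spec.map_id]
        exact congr($h c) }
  invFun Q := ⟨Spec.map (CommRingCat.ofHom Q.toRingHom), by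
    have h : Q.toRingHom.comp (algebraMap K A) = RingHom.id K := Q.comp_algebraMap
    rw [← Spec.map_comp, ← CommRingCat.ofHom_comp, h]
    exact Spec.map_id _⟩
  left_inv s := Subtype.ext (Spec.map_preimage s.1)
  right_inv Q := by
    ext a
    exact congr(($(Spec.preimage_map (CommRingCat.ofHom Q.toRingHom))).hom a)

end SmoothCurve

theorem etale_ringHom_comp {R S T : Type*} [CommRing R] [CommRing S] [CommRing T] {f : R →+* S}
    {g : S →+* T} (hf : f.Etale) (hg : g.Etale) : (g.comp f).Etale := by
  algebraize [f, g, g.comp f]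
  exact Algebra.Etale.comp R S T

theorem exists_etale_pushout {K M : Type*} {N : Type v} {D : Type w} (L : Type*) [CommRing K]
    [CommRing M] [Algebra K M] [CommRing N] [Algebra K N] [CommRing D] [Algebra K D] [CommRing L]
    [Algebra K L] (f : M →ₐ[K] D) (hf : f.toRingHom.Etale) (ρ : M →ₐ[K] N) :
    ∃ (E : Type (max v w)) (_ : CommRing E) (_ : Algebra K E) (g : D →ₐ[K] E) (h : N →ₐ[K] E),
      h.toRingHom.Etale ∧ g.comp f = h.comp ρ ∧
        ∀ (P : D →ₐ[K] L) (R : N →ₐ[K] L), P.comp f = R.comp ρ →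
          ∃ Q : E →ₐ[K] L, Q.comp g = P ∧ Q.comp h = R := by
  algebraize [f.toRingHom, ρ.toRingHom]
  have : IsScalarTower K M D := .of_algebraMap_eq' f.comp_algebraMap.symm
  have : IsScalarTower K M N := .of_algebraMap_eq' ρ.comp_algebraMap.symm
  have : Algebra.Etale M D := hf
  refine ⟨N ⊗[M] D, inferInstance, inferInstance,
    (Algebra.TensorProduct.includeRight : D →ₐ[M] N ⊗[M] D).restrictScalars K,
    (Algebra.TensorProduct.includeLeft : N →ₐ[M] N ⊗[M] D).restrictScalars K,
    RingHom.etale_algebraMap.mpr (inferInstance : Algebra.Etale N (N ⊗[M] D)), ?_,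
    fun P R hPR ↦ ?_⟩
  · ext m
    exact ((Algebra.TensorProduct.includeRight : D →ₐ[M] N ⊗[M] D).commutes m).trans
      ((Algebra.TensorProduct.includeLeft : N →ₐ[M] N ⊗[M] D).commutes m).symm
  · algebraize [(R.comp ρ).toRingHom]
    have : IsScalarTower K M L := .of_algebraMap_eq' (R.comp ρ).comp_algebraMap.symm
    let R' : N →ₐ[M] L := { R with commutes' := fun m ↦ rfl }
    let P' : D →ₐ[M] L := { P with commutes' := fun m ↦ congr($hPR m) }
    refine ⟨(Algebra.TensorProduct.lift R' P' fun _ _ ↦ .all _ _).restrictScalars K, ?_, ?_⟩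
    · ext d
      simp [P']
    · ext n
      simp [R']

section EtaleCoordinate

variable {K A B : Type*} [Field K] [CommRing A] [Algebra K A] [CommRing B] [Algebra K B] {x : A}

theorem IsEtaleCoordinate.map (hx : IsEtaleCoordinate K x) {g : A →ₐ[K] B}
    (hg : g.toRingHom.Etale) : IsEtaleCoordinate K (g x) := by
  have : (aeval (g x) : K[X] →ₐ[K] B).toRingHom = g.toRingHom.comp (aeval x).toRingHom :=
    congr(($(aeval_algHom g x)).toRingHom)
  rw [IsEtaleCoordinate, this]
  exact etale_ringHom_comp hx hg

theorem IsEtaleCoordinate.mul_add (hx : IsEtaleCoordinate K x) {c : K} (hc : c ≠ 0) (b : K) :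
    IsEtaleCoordinate K (algebraMap K A c * x + algebraMap K A b) := by
  let := invertibleOfNonzero hc
  let σ := algEquivCMulXAddC c b
  have : (aeval (algebraMap K A c * x + algebraMap K A b) : K[X] →ₐ[K] A) =
      (aeval x).comp (σ : K[X] →ₐ[K] K[X]) := by
    ext
    simp [σ]
  rw [IsEtaleCoordinate, this]
  exact etale_ringHom_comp (.of_bijective σ.bijective) hx

theorem IsEtaleCoordinate.finite_setOf_algHom_apply_eq (hx : IsEtaleCoordinate K x) (a : K) :
    {Q : A →ₐ[K] K | Q x = a}.Finite := by
  obtain ⟨E, _, _, g, h, hh, -, hlift⟩ :=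
    exists_etale_pushout K (aeval x : K[X] →ₐ[K] A) hx (aeval a : K[X] →ₐ[K] K)
  have : Algebra.Etale K E := by
    rw [← RingHom.etale_algebraMap]
    convert hh
    ext c
    exact (h.commutes c).symm
  have : Module.Finite K E := Algebra.FormallyUnramified.finite_of_free K E
  refine (Set.finite_range fun Q : E →ₐ[K] K ↦ Q.comp g).subset fun Q hQ ↦ ?_
  obtain ⟨Q', hQ', -⟩ := hlift Q (AlgHom.id K K) (by ext; simpa using hQ)
  exact ⟨Q', hQ'⟩

end EtaleCoordinate

/-- The subfield of `K` generated by the values of the function `x` at the `K`-rational points of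
`Spec A`. -/
def valueField (K : Type*) {A : Type*} [Field K] [CommRing A] [Algebra K A] (x : A) : Subfield K :=
  Subfield.closure (Set.range fun Q : A →ₐ[K] K ↦ Q x)

section ValueField

variable {K A B : Type*} [Field K] [CommRing A] [Algebra K A] [CommRing B] [Algebra K B]

theorem algHom_apply_mem_valueField (Q : A →ₐ[K] K) (x : A) : Q x ∈ valueField K x :=
  Subfield.subset_closure ⟨Q, rfl⟩

theorem valueField_algHom_le (g : A →ₐ[K] B) (x : A) : valueField K (g x) ≤ valueField K x :=
  Subfield.closure_mono (Set.range_subset_iff.mpr fun Q ↦ ⟨Q.comp g, rfl⟩)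

end ValueField

namespace IsAmpleField

variable {K A B : Type u} [Field K] [CommRing A] [Algebra K A] [CommRing B] [Algebra K B]
  {x : A} {y : B}

theorem infinite_algHom_of_isEtaleCoordinate (hK : IsAmpleField K) (hx : IsEtaleCoordinate K x)
    (P : A →ₐ[K] K) : Infinite (A →ₐ[K] K) := by
  have : (RingHom.ker P).IsPrime := RingHom.ker_isPrime _
  have := hx.finiteType
  have := Algebra.FiniteType.isNoetherianRing K A
  obtain ⟨f, hf, g, hg⟩ := exists_away_algHom_atPrime_injective (RingHom.ker P)
  have hdomain (L : Type u) [Field L] [Algebra K L] : IsDomain (Localization.Away f ⊗[K] L) := by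
    have := hx.isDomain_localization_tensorProduct P L
    have hinj : Function.Injective
        (Algebra.TensorProduct.map (g.restrictScalars K) (AlgHom.id K L)) :=
      Module.Flat.rTensor_preserves_injective_linearMap (g.restrictScalars K).toLinearMap hg
    exact hinj.isDomain
      (Algebra.TensorProduct.map (g.restrictScalars K) (AlgHom.id K L)).toRingHom
  let ι : A →ₐ[K] Localization.Away f := IsScalarTower.toAlgHom K A (Localization.Away f)
  have hι : ι.toRingHom.Etale :=
    RingHom.etale_algebraMap.mpr (.of_isLocalizationAway f)
  have : Infinite (Localization.Away f →ₐ[K] K) :=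
    (rationalPointEquiv K (Localization.Away f)).infinite_iff.mp <|
      hK _ _ ((hx.map hι).isSmoothCurve hdomain)
        ⟨(rationalPointEquiv K _).symm (IsLocalization.Away.liftAlgHom f (IsUnit.mk0 (P f) hf))⟩
  refine Infinite.of_injective (fun Q : Localization.Away f →ₐ[K] K ↦ Q.comp ι) fun Q Q' h ↦ ?_
  exact AlgHom.coe_ringHom_injective
    (IsLocalization.ringHom_ext (Submonoid.powers f) congr(($h : A →+* K)))

theorem infinite_range_of_isEtaleCoordinate (hK : IsAmpleField K) (hx : IsEtaleCoordinate K x)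
    (P : A →ₐ[K] K) : (Set.range fun Q : A →ₐ[K] K ↦ Q x).Infinite := by
  intro hfin
  have := hK.infinite_algHom_of_isEtaleCoordinate hx P
  refine Set.infinite_univ (α := A →ₐ[K] K) ((hfin.biUnion fun a _ ↦
    hx.finite_setOf_algHom_apply_eq a).subset fun Q _ ↦ ?_)
  exact Set.mem_biUnion (Set.mem_range_self Q) rfl

theorem infinite_range_inter_range_of_isEtaleCoordinate (hK : IsAmpleField K)
    (hx : IsEtaleCoordinate K x) (hy : IsEtaleCoordinate K y) {P : A →ₐ[K] K} {P' : B →ₐ[K] K}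
    (h : P x = P' y) :
    (Set.range (fun Q : A →ₐ[K] K ↦ Q x) ∩ Set.range fun Q : B →ₐ[K] K ↦ Q y).Infinite := by
  obtain ⟨E, _, _, g, f, hf, hgf, hlift⟩ :=
    exists_etale_pushout K (aeval x : K[X] →ₐ[K] A) hx (aeval y : K[X] →ₐ[K] B)
  obtain ⟨PE, -, -⟩ := hlift P P' (by ext; simpa using h)
  have hxy : g x = f y := by simpa using congr($hgf X)
  refine (hK.infinite_range_of_isEtaleCoordinate (hy.map hf) PE).mono ?_
  rintro _ ⟨Q, rfl⟩
  exact ⟨⟨Q.comp g, congr(Q $hxy)⟩, Q.comp f, rfl⟩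

/-- For `c` outside of a subfield that contains the values of `x`, the étale coordinates `x` and
`P x + c (x - P x)` have no common value other than `P x`. -/
theorem valueField_eq_top_of_isEtaleCoordinate (hK : IsAmpleField K) (hx : IsEtaleCoordinate K x)
    (P : A →ₐ[K] K) : valueField K x = ⊤ := by
  by_contra hne
  obtain ⟨c, hc⟩ : ∃ c, c ∉ valueField K x := by
    by_contra! h
    exact hne (eq_top_iff.mpr fun c _ ↦ h c)
  have hc0 : c ≠ 0 := fun h ↦ hc (h ▸ zero_mem _)
  have hcommon := hK.infinite_range_inter_range_of_isEtaleCoordinate hx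
    (hx.mul_add hc0 (P x - c * P x)) (P := P) (P' := P) (by simp)
  refine hcommon ((Set.finite_singleton (P x)).subset ?_)
  rintro _ ⟨⟨Q, rfl⟩, Q', hQ'⟩
  have hQQ' : Q x - P x = c * (Q' x - P x) := by
    simp only [map_add, map_mul, map_sub, AlgHom.commutes, Algebra.algebraMap_self_apply] at hQ'
    linear_combination -hQ'
  have hmem (R : A →ₐ[K] K) : R x - P x ∈ valueField K x :=
    sub_mem (algHom_apply_mem_valueField R x) (algHom_apply_mem_valueField P x)
  by_contra hQ
  have hQ'0 : Q' x - P x ≠ 0 := fun h ↦ hQ (sub_eq_zero.mp (by rw [hQQ', h, mul_zero]))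
  exact hc (eq_div_of_mul_eq hQ'0 hQQ'.symm ▸ div_mem (hmem Q) (hmem Q'))

end IsAmpleField

theorem isEtaleCoordinate_X (K : Type*) [Field K] : IsEtaleCoordinate K (X : K[X]) := by
  rw [IsEtaleCoordinate, aeval_X_left]
  exact .of_bijective Function.bijective_id

/-- The function `x` on `Spec A` is a smooth coordinate over `K`: it defines a smooth morphism from
`Spec A` to the affine line. -/
def IsSmoothCoordinate (K : Type*) {A : Type*} [CommRing K] [CommRing A] [Algebra K A] (x : A) :
    Prop :=
  (aeval x : K[X] →ₐ[K] A).toRingHom.Smooth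

theorem IsSmoothCoordinate.exists_etale_mvPolynomial {K A : Type*} [Field K] [CommRing A]
    [Algebra K A] {x : A} (hx : IsSmoothCoordinate K x) (p : Ideal A) [p.IsPrime] :
    ∃ f ∉ p, ∃ (n : ℕ) (φ : MvPolynomial (Fin n) K[X] →ₐ[K] Localization.Away f),
      φ.toRingHom.Etale ∧ φ (MvPolynomial.C X) = algebraMap A _ x := by
  algebraize [(aeval x : K[X] →ₐ[K] A).toRingHom]
  have : Algebra.Smooth K[X] A := hx
  have : IsScalarTower K K[X] A := .of_algebraMap_eq' (aeval x).comp_algebraMap.symm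
  have : Algebra.IsSmoothAt K[X] p := by
    have : Algebra.FormallySmooth A (Localization.AtPrime p) := .of_isLocalization p.primeCompl
    exact Algebra.FormallySmooth.comp K[X] A _
  obtain ⟨f, hf, n, _, _, _⟩ :=
    Algebra.IsSmoothAt.exists_isStandardEtale_mvPolynomial (R := K[X]) (p := p)
  let φ : MvPolynomial (Fin n) K[X] →ₐ[K] Localization.Away f :=
    (IsScalarTower.toAlgHom K[X] (MvPolynomial (Fin n) K[X]) _).restrictScalars K
  refine ⟨f, hf, n, φ, RingHom.etale_algebraMap.mpr inferInstance, ?_⟩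
  have hX : algebraMap K[X] A X = x := aeval_X x
  rw [← hX, ← IsScalarTower.algebraMap_apply]
  exact (IsScalarTower.toAlgHom K[X] (MvPolynomial (Fin n) K[X]) (Localization.Away f)).commutes X

theorem IsAmpleField.valueField_eq_top_of_isSmoothCoordinate {K A : Type u} [Field K] [CommRing A]
    [Algebra K A] {x : A} (hK : IsAmpleField K) (hx : IsSmoothCoordinate K x) (P : A →ₐ[K] K) :
    valueField K x = ⊤ := by
  have : (RingHom.ker P).IsPrime := RingHom.ker_isPrime _
  obtain ⟨f, hf, n, φ, hφ, hφx⟩ := hx.exists_etale_mvPolynomial (RingHom.ker P)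
  let Pf : Localization.Away f →ₐ[K] K := IsLocalization.Away.liftAlgHom f (IsUnit.mk0 (P f) hf)
  let ρ : MvPolynomial (Fin n) K[X] →ₐ[K] K[X] :=
    (MvPolynomial.aeval fun i ↦ C (Pf (φ (.X i))) :
      MvPolynomial (Fin n) K[X] →ₐ[K[X]] K[X]).restrictScalars K
  have hρ : Pf.comp φ = (aeval (P x)).comp ρ := by
    apply MvPolynomial.algHom_ext'
    · ext
      simp [ρ, Pf, hφx]
    · intro i
      simp [ρ]
  obtain ⟨E, _, _, g, h, hh, hgh, hlift⟩ := exists_etale_pushout K φ hφ ρ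
  obtain ⟨PE, -, -⟩ := hlift Pf (aeval (P x)) hρ
  have hgx : g (algebraMap A _ x) = h X := by
    simpa [ρ, hφx] using congr($hgh (MvPolynomial.C X))
  rw [eq_top_iff, ← hK.valueField_eq_top_of_isEtaleCoordinate ((isEtaleCoordinate_X K).map hh) PE,
    ← hgx]
  exact valueField_algHom_le (g.comp (IsScalarTower.toAlgHom K A _)) x

theorem linearIndependent_fieldRange_frobenius_pow {E : Type*} [Field E] (p : ℕ) [hp : Fact p.Prime]
    [CharP E p] {x : E} (hx : ∀ y : E, y ^ p ≠ x) :
    LinearIndependent (frobenius E p).fieldRange fun j : Fin p ↦ x ^ (j : ℕ) := by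
  let a : (frobenius E p).fieldRange := ⟨x ^ p, x, rfl⟩
  have hirr : Irreducible (X ^ p - C a) := by
    apply X_pow_sub_C_irreducible_of_prime hp.out
    rintro ⟨_, b, rfl⟩ hb
    exact hx b (frobenius_inj E p congr($hb))
  have hmin : X ^ p - C a = minpoly (frobenius E p).fieldRange x := by
    refine minpoly.eq_of_irreducible_of_monic hirr ?_ (monic_X_pow_sub_C a hp.out.ne_zero)
    rw [map_sub, map_pow, aeval_X, aeval_C]
    exact sub_self _
  have hli := linearIndependent_pow (K := (frobenius E p).fieldRange) x
  rwa [← hmin, natDegree_X_pow_sub_C] at hli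

theorem exists_eq_sum_pow_mul_X_pow {R : Type*} [CommRing R] (p : ℕ) [hp : Fact p.Prime]
    [CharP R p] [PerfectRing R p] (q : R[X]) :
    ∃ g : Fin p → R[X], q = ∑ j, g j ^ p * X ^ (j : ℕ) := by
  induction q using Polynomial.induction_on' with
  | add q r hq hr =>
    obtain ⟨g, rfl⟩ := hq
    obtain ⟨h, rfl⟩ := hr
    refine ⟨g + h, ?_⟩
    simp only [← Finset.sum_add_distrib, Pi.add_apply, add_pow_char, add_mul]
  | monomial n c =>
    obtain ⟨d, rfl⟩ := surjective_frobenius R p c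
    let r : Fin p := ⟨n % p, Nat.mod_lt _ hp.out.pos⟩
    refine ⟨Pi.single r (C d * X ^ (n / p)), ?_⟩
    rw [Finset.sum_eq_single r (fun j _ hj ↦ by
      rw [Pi.single_eq_of_ne hj, zero_pow hp.out.ne_zero, zero_mul]) (by simp), Pi.single_eq_same]
    rw [← C_mul_X_pow_eq_monomial, frobenius_def, C_pow, mul_pow, ← pow_mul, mul_assoc, ← pow_add,
      Nat.div_add_mod']

theorem exists_eq_sum_pow_mul_pow_of_isFractionRing {R k : Type*} [CommRing R] [Field k]
    [Algebra R k] [IsFractionRing R k] {n : ℕ} (hn : n ≠ 0) {x : R}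
    (hx : ∀ r : R, ∃ g : Fin n → R, r = ∑ j, g j ^ n * x ^ (j : ℕ)) (f : k) :
    ∃ g : Fin n → k, f = ∑ j, g j ^ n * algebraMap R k x ^ (j : ℕ) := by
  obtain ⟨a, b, hb, rfl⟩ := IsFractionRing.div_surjective R f
  have : Nontrivial R := (algebraMap R k).domain_nontrivial
  have hb0 : algebraMap R k b ≠ 0 :=
    IsLocalization.to_map_ne_zero_of_mem_nonZeroDivisors k le_rfl hb
  obtain ⟨g, hg⟩ := hx (a * b ^ (n - 1))
  refine ⟨fun j ↦ algebraMap R k (g j) / algebraMap R k b, ?_⟩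
  calc algebraMap R k a / algebraMap R k b
    _ = algebraMap R k (a * b ^ (n - 1)) / algebraMap R k b ^ n := by
      rw [div_eq_div_iff hb0 (pow_ne_zero _ hb0), map_mul, map_pow, mul_assoc, pow_sub_one_mul hn]
    _ = ∑ j, (algebraMap R k (g j) / algebraMap R k b) ^ n * algebraMap R k x ^ (j : ℕ) := by
      simp only [hg, map_sum, map_mul, map_pow, Finset.sum_div, div_pow, div_mul_eq_mul_div]

/-- The powers of `x` below the `p`-th span `k` over `k ^ p` and are independent over `E ^ p`, so a
linear relation between the `v i ^ p` splits into `p` relations between the `v i`. -/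
theorem linearIndependent_pow_char_of_forall_pow_ne {k E ι : Type*} [Field k] [Field E]
    [Algebra k E] (p : ℕ) [hp : Fact p.Prime] [CharP E p] {x : k}
    (hxE : ∀ y : E, y ^ p ≠ algebraMap k E x)
    (hxk : ∀ c : k, ∃ g : Fin p → k, c = ∑ j, g j ^ p * x ^ (j : ℕ)) {v : ι → E}
    (hv : LinearIndependent k v) : LinearIndependent k fun i ↦ v i ^ p := by
  rw [linearIndependent_iff'] at hv ⊢
  intro s c hc i hi
  choose g hg using fun i ↦ hxk (c i)
  let y (j : Fin p) : E := ∑ i ∈ s, g i j • v i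
  have hy : ∑ j, y j ^ p * algebraMap k E x ^ (j : ℕ) = 0 := by
    rw [← hc]
    simp only [y, hg, sum_pow_char, Finset.sum_mul, Algebra.smul_def, mul_pow, map_sum, map_mul,
      map_pow]
    rw [Finset.sum_comm]
    simp only [mul_right_comm]
  have hy0 (j : Fin p) : y j = 0 := by
    have hli := linearIndependent_fieldRange_frobenius_pow p hxE
    rw [Fintype.linearIndependent_iff] at hli
    rw [← map_eq_zero (frobenius E p).rangeRestrictField]
    exact hli (fun j ↦ (frobenius E p).rangeRestrictField (y j)) hy j
  rw [hg i]
  refine Finset.sum_eq_zero fun j _ ↦ ?_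
  rw [hv s (fun i ↦ g i j) (hy0 j) i hi, zero_pow hp.out.ne_zero, zero_mul]

theorem formallySmooth_fractionRing_polynomial_of_forall_pow_ne {K k E : Type*} [Field K]
    [PerfectField K] [Field k] [Field E] [Algebra K[X] k] [IsFractionRing K[X] k] [Algebra k E]
    [Algebra.EssFiniteType k E]
    (hpow : ∀ p : ℕ, p.Prime → CharP K p → ∀ y : E, y ^ p ≠ algebraMap k E (algebraMap K[X] k X)) :
    Algebra.FormallySmooth k E := by
  have hK : Function.Injective ((algebraMap K[X] k).comp C) :=
    (IsFractionRing.injective K[X] k).comp C_injective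
  obtain _ | ⟨p, hp, hpK⟩ := CharP.exists' K
  · have : CharZero k := charZero_of_injective_ringHom hK
    infer_instance
  have : CharP k p := charP_of_injective_ringHom hK p
  have : CharP E p := charP_of_injective_algebraMap (algebraMap k E).injective p
  have : ExpChar k p := .prime hp.out
  have : PerfectRing K p := PerfectField.toPerfectRing p
  obtain ⟨s, hs, hsep⟩ :=
    exists_isTranscendenceBasis_and_isSeparable_of_linearIndepOn_pow_of_essFiniteType (k := k)
      (K := E) p hp.out fun s hs ↦ linearIndependent_pow_char_of_forall_pow_ne p
        (hpow p hp.out hpK) (exists_eq_sum_pow_mul_pow_of_isFractionRing hp.out.ne_zero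
          (exists_eq_sum_pow_mul_X_pow p)) hs
  have : Algebra.IsSeparable (IntermediateField.adjoin k (Set.range ((↑) : s → E))) E := by
    convert! hsep <;> simp
  exact .of_algebraicIndependent_of_isSeparable hs.1

theorem exists_intermediateField_transcendental_and_finiteDimensional {K E : Type*} [Field K]
    [Field E] [Algebra K E] [Algebra.EssFiniteType K E] {x : E} (hx : Transcendental K x) :
    ∃ k : IntermediateField K E, Transcendental k x ∧
      FiniteDimensional (IntermediateField.adjoin k {x}) E := by
  obtain ⟨t, hxt, ht⟩ := exists_isTranscendenceBasis_superset (R := K) (s := {x})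
    (by simpa [AlgebraicIndepOn] using hx)
  let k := IntermediateField.adjoin K (t \ {x})
  refine ⟨k, ?_, ?_⟩
  · have himage : ((↑) : t → E) '' {i | i.1 ≠ x} = t \ {x} := by
      ext y
      simp [and_comm]
    rw [IntermediateField.transcendental_adjoin_iff, ← himage]
    exact ht.1.transcendental_adjoin (i := ⟨x, hxt rfl⟩) (by simp)
  · have hadjoin : (IntermediateField.adjoin k {x}).restrictScalars K =
        IntermediateField.adjoin K (Set.range ((↑) : t → E)) := by
      rw [IntermediateField.adjoin_adjoin_left, Subtype.range_coe, Set.sdiff_union_of_subset hxt]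
    have : Algebra.EssFiniteType k E := .of_comp K k E
    have : Algebra.EssFiniteType (IntermediateField.adjoin k {x}) E := .of_comp k _ E
    have : Algebra.IsAlgebraic (IntermediateField.adjoin k {x}) E := by
      have halg := ht.isAlgebraic_field
      rw [← hadjoin] at halg
      exact halg
    exact Algebra.finite_of_essFiniteType_of_isAlgebraic

theorem finiteDimensional_and_finrank_adjoin_simple_lt_of_pow {k E : Type*} [Field k] [Field E]
    [Algebra k E] {n : ℕ} (hn : n ≠ 1) {y : E} (hy : Transcendental k (y ^ n))
    [FiniteDimensional (IntermediateField.adjoin k {y ^ n}) E] :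
    FiniteDimensional (IntermediateField.adjoin k {y}) E ∧
    Module.finrank (IntermediateField.adjoin k {y}) E <
      Module.finrank (IntermediateField.adjoin k {y ^ n}) E := by
  have hlt : IntermediateField.adjoin k {y ^ n} < IntermediateField.adjoin k {y} := by
    refine lt_of_le_of_ne (IntermediateField.adjoin_simple_le_iff.mpr
      (pow_mem (IntermediateField.mem_adjoin_simple_self k y) _)) fun heq ↦ hy ?_
    refine (Field.isAlgebraic_of_adjoin_eq_adjoin k E hn (α := y) ?_).pow _
    rw [heq, pow_one]
  refine ⟨?_, IntermediateField.finrank_lt_of_gt hlt⟩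
  let := (IntermediateField.inclusion hlt.le).toAlgebra
  have : IsScalarTower (IntermediateField.adjoin k {y ^ n}) (IntermediateField.adjoin k {y}) E :=
    .of_algebraMap_eq' rfl
  exact .of_restrictScalars_finite (IntermediateField.adjoin k {y ^ n}) _ _

theorem exists_pow_eq_and_forall_pow_ne {K E : Type*} [Field K] [Field E] [Algebra K E]
    [Algebra.EssFiniteType K E] {q : ℕ} (hq : q ≠ 1) {x : E} (hx : Transcendental K x) :
    ∃ (n : ℕ) (z : E), z ^ q ^ n = x ∧ ∀ y, y ^ q ≠ z := by
  obtain ⟨k, hxk, _⟩ := exists_intermediateField_transcendental_and_finiteDimensional hx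
  clear hx
  induction hd : Module.finrank (IntermediateField.adjoin k {x}) E
    using Nat.strong_induction_on generalizing x with
  | _ d ih =>
  by_cases hroot : ∃ y, y ^ q = x
  · obtain ⟨y, rfl⟩ := hroot
    obtain ⟨_, hlt⟩ := finiteDimensional_and_finrank_adjoin_simple_lt_of_pow hq hxk
    obtain ⟨n, z, hzy, hz⟩ := ih _ (hd ▸ hlt) (fun h ↦ hxk (h.pow q)) inferInstance rfl
    exact ⟨n + 1, z, by rw [pow_succ, pow_mul, hzy], hz⟩
  · exact ⟨0, x, by rw [pow_zero, pow_one], not_exists.mp hroot⟩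

theorem exists_pow_eq_and_forall_prime_pow_ne {K E : Type*} [Field K] [PerfectField K] [Field E]
    [Algebra K E] [Algebra.EssFiniteType K E] {x : E} (hx : Transcendental K x) :
    ∃ (m : ℕ) (φ : K →+* K) (z : E), Function.Surjective φ ∧ (∀ y, φ y = y ^ m) ∧ z ^ m = x ∧
      ∀ p : ℕ, p.Prime → CharP K p → ∀ y : E, y ^ p ≠ z := by
  obtain _ | ⟨p, hp, hpK⟩ := CharP.exists' K
  · refine ⟨1, .id K, x, Function.surjective_id, by simp, pow_one x, fun p hp hpK ↦ ?_⟩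
    exact absurd (CharP.eq K hpK (CharP.ofCharZero K)) hp.ne_zero
  · obtain ⟨n, z, hz, hpow⟩ := exists_pow_eq_and_forall_pow_ne hp.out.ne_one hx
    have : PerfectRing K p := PerfectField.toPerfectRing p
    refine ⟨p ^ n, iterateFrobenius K p n, z, (bijective_iterateFrobenius K p n).surjective,
      fun y ↦ iterateFrobenius_def .., hz, fun q _ hqK ↦ ?_⟩
    obtain rfl := CharP.eq K hqK hpK
    exact hpow

theorem formallySmooth_polynomial_of_forall_pow_ne {K E : Type*} [Field K] [PerfectField K]
    [Field E] [Algebra K E] [Algebra.EssFiniteType K E] [Algebra K[X] E] [FaithfulSMul K[X] E]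
    [IsScalarTower K K[X] E]
    (hpow : ∀ p : ℕ, p.Prime → CharP K p → ∀ y : E, y ^ p ≠ algebraMap K[X] E X) :
    Algebra.FormallySmooth K[X] E := by
  let k := FractionRing K[X]
  let : Algebra k E := FractionRing.liftAlgebra K[X] E
  have : IsScalarTower K k E := .to₁₃₄ K K[X] k E
  have : Algebra.EssFiniteType k E := .of_comp K k E
  have : Algebra.FormallySmooth k E := by
    apply formallySmooth_fractionRing_polynomial_of_forall_pow_ne (K := K)
    rwa [← IsScalarTower.algebraMap_apply]
  have : Algebra.FormallySmooth K[X] k := .of_isLocalization (nonZeroDivisors K[X])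
  exact .comp K[X] k E

theorem exists_smooth_away (R D E : Type*) [CommRing R] [CommRing D] [IsDomain D] [Algebra R D]
    [Algebra.FinitePresentation R D] [Field E] [Algebra D E] [IsFractionRing D E] [Algebra R E]
    [IsScalarTower R D E] [Algebra.FormallySmooth R E] :
    ∃ g : D, g ≠ 0 ∧ Algebra.Smooth R (Localization.Away g) := by
  have : IsLocalization (⊥ : Ideal D).primeCompl E := by
    rwa [Ideal.primeCompl_bot]
  have : Algebra.IsSmoothAt R (⊥ : Ideal D) := .of_equiv
    ((IsLocalization.algEquiv (⊥ : Ideal D).primeCompl E _).restrictScalars R)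
  exact Algebra.IsSmoothAt.exists_notMem_smooth R (⊥ : Ideal D)

theorem exists_isSmoothCoordinate_away {K D : Type*} (E : Type*) [Field K] [PerfectField K]
    [CommRing D] [IsDomain D] [Algebra K D] [Algebra.FiniteType K D] [Field E] [Algebra D E]
    [IsFractionRing D E] [Algebra K E] [IsScalarTower K D E] {x : D} (hx : Transcendental K x)
    (hpow : ∀ p : ℕ, p.Prime → CharP K p → ∀ y : E, y ^ p ≠ algebraMap D E x) :
    ∃ g : D, g ≠ 0 ∧ IsSmoothCoordinate K (algebraMap D (Localization.Away g) x) := by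
  algebraize [(aeval x : K[X] →ₐ[K] D).toRingHom]
  algebraize [(algebraMap D E).comp (algebraMap K[X] D)]
  have : IsScalarTower K K[X] D := .of_algebraMap_eq' (aeval x).comp_algebraMap.symm
  have : IsScalarTower K K[X] E := .to₁₂₄ K K[X] D E
  have : FaithfulSMul K[X] E := (faithfulSMul_iff_algebraMap_injective _ _).mpr
    ((IsFractionRing.injective D E).comp (transcendental_iff_injective.mp hx))
  have hX : algebraMap K[X] D X = x := aeval_X x
  have : Algebra.EssFiniteType D E := .of_isLocalization E (nonZeroDivisors D)
  have : Algebra.EssFiniteType K E := .comp K D E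
  have : Algebra.FormallySmooth K[X] E := by
    apply formallySmooth_polynomial_of_forall_pow_ne
    rwa [IsScalarTower.algebraMap_apply K[X] D E, hX]
  have : Algebra.FiniteType K[X] D := .of_restrictScalars_finiteType K K[X] D
  have : Algebra.FinitePresentation K[X] D := Algebra.FinitePresentation.of_finiteType.mp this
  obtain ⟨g, hg, hsmooth⟩ := exists_smooth_away K[X] D E
  have haeval : aeval (algebraMap D (Localization.Away g) x) =
      IsScalarTower.toAlgHom K K[X] (Localization.Away g) := by
    ext
    rw [aeval_X, IsScalarTower.toAlgHom_apply, IsScalarTower.algebraMap_apply K[X] D, hX]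
  refine ⟨g, hg, ?_⟩
  rw [IsSmoothCoordinate, haeval]
  exact RingHom.smooth_algebraMap.mpr hsmooth

/-- The `K`-rational points of the affine variety `Spec D` are Zariski dense. -/
def HasDenseRationalPoints (K D : Type*) [CommRing K] [CommRing D] [Algebra K D] : Prop :=
  ∀ h : D, h ≠ 0 → ∃ Q : D →ₐ[K] K, Q h ≠ 0

theorem HasDenseRationalPoints.of_isLocalization_away {K D D' : Type*} [Field K] [CommRing D]
    [IsDomain D] [Algebra K D] [CommRing D'] [Algebra D D'] [Algebra K D'] [IsScalarTower K D D']
    (hD : HasDenseRationalPoints K D) {b : D} (hb : b ≠ 0) [IsLocalization.Away b D'] :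
    HasDenseRationalPoints K D' := by
  intro h hh
  obtain ⟨⟨c, s⟩, hcs⟩ := IsLocalization.surj (Submonoid.powers b) h
  have hc : c ≠ 0 := by
    rintro rfl
    rw [map_zero] at hcs
    exact hh ((IsLocalization.map_units D' s).mul_left_eq_zero.mp hcs)
  obtain ⟨Q, hQ⟩ := hD (b * c) (mul_ne_zero hb hc)
  rw [map_mul, mul_ne_zero_iff] at hQ
  let Q' : D' →ₐ[K] K := IsLocalization.Away.liftAlgHom b (f := Q) (IsUnit.mk0 _ hQ.1)
  have hQ' : Q' (algebraMap D D' c) = Q c := by simp [Q']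
  refine ⟨Q', fun h0 ↦ hQ.2 ?_⟩
  rw [← hQ', ← hcs, map_mul, h0, zero_mul]

theorem exists_isLocalization_away_mem {D E : Type*} [CommRing D] [IsDomain D] [Field E]
    [Algebra D E] [IsFractionRing D E] (z : E) :
    ∃ b : D, b ≠ 0 ∧ ∃ D' : Subalgebra D E, IsLocalization.Away b D' ∧ z ∈ D' := by
  obtain ⟨a, b, hb, rfl⟩ := IsFractionRing.div_surjective D z
  have hle : Submonoid.powers b ≤ nonZeroDivisors D := Submonoid.powers_le.mpr hb
  refine ⟨b, nonZeroDivisors.ne_zero hb, Localization.subalgebra.ofField E _ hle,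
    Localization.subalgebra.isLocalization_ofField E _ hle, ?_⟩
  exact ⟨a, b, Submonoid.mem_powers b, div_eq_mul_inv ..⟩

theorem map_valueField {K A : Type*} [Field K] [CommRing A] [Algebra K A] {φ : K →+* K} {m : ℕ}
    (hφ : ∀ y, φ y = y ^ m) (x : A) : (valueField K x).map φ = valueField K (x ^ m) := by
  rw [valueField, valueField, RingHom.map_field_closure, ← Set.range_comp]
  simp only [Function.comp_def, hφ, map_pow]

theorem IsAmpleField.valueField_eq_top_of_forall_pow_ne {K D : Type u} {E : Type*} [Field K]
    [PerfectField K] [CommRing D] [IsDomain D] [Algebra K D] [Algebra.FiniteType K D] [Field E]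
    [Algebra D E] [IsFractionRing D E] [Algebra K E] [IsScalarTower K D E] (hK : IsAmpleField K)
    (hD : HasDenseRationalPoints K D) {x : D} (hx : Transcendental K x)
    (hpow : ∀ p : ℕ, p.Prime → CharP K p → ∀ y : E, y ^ p ≠ algebraMap D E x) :
    valueField K x = ⊤ := by
  obtain ⟨g, hg, hsmooth⟩ := exists_isSmoothCoordinate_away E hx hpow
  obtain ⟨Q, hQ⟩ := hD g hg
  rw [eq_top_iff, ← hK.valueField_eq_top_of_isSmoothCoordinate hsmooth
    (IsLocalization.Away.liftAlgHom g (IsUnit.mk0 (Q g) hQ))]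
  exact valueField_algHom_le (IsScalarTower.toAlgHom K D (Localization.Away g)) x

theorem IsAmpleField.valueField_eq_top {K D : Type u} [Field K] [PerfectField K] [CommRing D]
    [IsDomain D] [Algebra K D] [Algebra.FiniteType K D] (hK : IsAmpleField K)
    (hD : HasDenseRationalPoints K D) {x : D} (hx : Transcendental K x) : valueField K x = ⊤ := by
  let E := FractionRing D
  have : Algebra.EssFiniteType D E := .of_isLocalization E (nonZeroDivisors D)
  have : Algebra.EssFiniteType K E := .comp K D E
  obtain ⟨m, φ, z, hφ, hφm, hzm, hpow⟩ := exists_pow_eq_and_forall_prime_pow_ne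
    ((transcendental_algebraMap_iff (IsFractionRing.injective D E)).mpr hx)
  obtain ⟨b, hb, D', _, hz⟩ := exists_isLocalization_away_mem (D := D) z
  let z' : D' := ⟨z, hz⟩
  have hz' : z' ^ m = algebraMap D D' x := Subtype.ext hzm
  have hz't : Transcendental K z' := fun h ↦ hx <|
    (isAlgebraic_algebraMap_iff (FaithfulSMul.algebraMap_injective D D')).mp (hz' ▸ h.pow m)
  have : Algebra.FinitePresentation D D' := IsLocalization.Away.finitePresentation b
  have : Algebra.FiniteType K D' := .trans (S := D) inferInstance inferInstance
  have hz'top : valueField K z' = ⊤ :=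
    hK.valueField_eq_top_of_forall_pow_ne (E := E) (hD.of_isLocalization_away hb) hz't hpow
  rw [eq_top_iff, ← RingHom.fieldRange_eq_top_iff.mpr hφ, RingHom.fieldRange_eq_map, ← hz'top,
    map_valueField hφm, hz']
  exact valueField_algHom_le (IsScalarTower.toAlgHom K D D') x

/-- On every irreducible closed subset of affine space, given by a prime ideal, the set `S` of
`K`-rational points contains or avoids all the points of some nonempty open subset. Constructible
sets have this property. -/
def IsGenericallyDecided {K σ : Type*} [Field K] (S : Set (σ → K)) : Prop :=
  ∀ I : Ideal (MvPolynomial σ K), I.IsPrime → ∃ f ∉ I,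
    {w ∈ MvPolynomial.zeroLocus K I | MvPolynomial.aeval w f ≠ 0} ⊆ S ∨
    {w ∈ MvPolynomial.zeroLocus K I | MvPolynomial.aeval w f ≠ 0} ⊆ Sᶜ

namespace IsGenericallyDecided

variable {K σ : Type*} [Field K] {S T : Set (σ → K)}

theorem empty : IsGenericallyDecided (∅ : Set (σ → K)) := by
  intro I hI
  exact ⟨1, hI.one_notMem, .inr (by simp)⟩

theorem setOf_aeval_eq_zero (p : MvPolynomial σ K) :
    IsGenericallyDecided {w : σ → K | MvPolynomial.aeval w p = 0} := by
  intro I hI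
  by_cases hp : p ∈ I
  · exact ⟨1, hI.one_notMem, .inl fun w hw ↦ hw.1 p hp⟩
  · exact ⟨p, hp, .inr fun w hw ↦ hw.2⟩

theorem compl_union (hS : IsGenericallyDecided S) (hT : IsGenericallyDecided T) :
    IsGenericallyDecided (Sᶜ ∪ T) := by
  intro I hI
  obtain ⟨f, hf, hS⟩ := hS I hI
  obtain ⟨g, hg, hT⟩ := hT I hI
  refine ⟨f * g, hI.mul_notMem hf hg, ?_⟩
  simp only [map_mul, mul_ne_zero_iff]
  rcases hS with hS | hS
  · rcases hT with hT | hT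
    · exact .inl fun w ⟨hw, _, hwg⟩ ↦ .inr (hT ⟨hw, hwg⟩)
    · refine .inr fun w ⟨hw, hwf, hwg⟩ hwST ↦ ?_
      exact hwST.elim (fun h ↦ h (hS ⟨hw, hwf⟩)) (hT ⟨hw, hwg⟩)
  · exact .inl fun w ⟨hw, hwf, _⟩ ↦ .inl (hS ⟨hw, hwf⟩)

end IsGenericallyDecided

section Definability

open FirstOrder Language

theorem exists_mvPolynomial_realize_ring {R β : Type*} [CommRing R] [Ring.CompatibleRing R]
    (t : Language.ring.Term β) :
    ∃ p : MvPolynomial β R, ∀ w : β → R, t.realize w = MvPolynomial.aeval w p := by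
  induction t with
  | var i => exact ⟨.X i, fun w ↦ by simp⟩
  | func f ts ih =>
    choose p hp using ih
    have hf (w : β → R) : (Term.func f ts).realize w =
        Structure.funMap f fun i ↦ MvPolynomial.aeval w (p i) := by
      simp only [Term.realize_func, hp]
    simp only [hf]
    cases f with
    | add => exact ⟨p 0 + p 1, fun w ↦ by rw [map_add]; exact Ring.CompatibleRing.funMap_add _⟩
    | mul => exact ⟨p 0 * p 1, fun w ↦ by rw [map_mul]; exact Ring.CompatibleRing.funMap_mul _⟩
    | neg => exact ⟨-p 0, fun w ↦ by rw [map_neg]; exact Ring.CompatibleRing.funMap_neg _⟩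
    | zero => exact ⟨0, fun w ↦ by rw [map_zero]; exact Ring.CompatibleRing.funMap_zero _⟩
    | one => exact ⟨1, fun w ↦ by rw [map_one]; exact Ring.CompatibleRing.funMap_one _⟩

theorem exists_mvPolynomial_realize {R β : Type*} [CommRing R] [Ring.CompatibleRing R] {A : Set R}
    (t : Language.ring[[A]].Term β) :
    ∃ p : MvPolynomial β R, ∀ w : β → R, t.realize w = MvPolynomial.aeval w p := by
  obtain ⟨p, hp⟩ := exists_mvPolynomial_realize_ring (R := R) t.constantsToVars
  refine ⟨MvPolynomial.aeval (Sum.elim (fun a : A ↦ .C a.1) .X) p, fun w ↦ ?_⟩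
  rw [← Term.realize_constantsToVars, hp, ← AlgHom.comp_apply, MvPolynomial.comp_aeval]
  congr 2
  ext (a | i) <;> simp

theorem isGenericallyDecided_setOf_realize {K α : Type*} [Field K] [Ring.CompatibleRing K]
    {A : Set K} {n : ℕ} {φ : Language.ring[[A]].BoundedFormula α n} (hφ : φ.IsQF) :
    IsGenericallyDecided {w : α ⊕ Fin n → K | φ.Realize (w ∘ Sum.inl) (w ∘ Sum.inr)} := by
  induction hφ with
  | falsum => exact .empty
  | of_isAtomic h =>
    cases h with
    | equal t₁ t₂ =>
      obtain ⟨p, hp⟩ := exists_mvPolynomial_realize t₁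
      obtain ⟨q, hq⟩ := exists_mvPolynomial_realize t₂
      convert! IsGenericallyDecided.setOf_aeval_eq_zero (p - q) using 3 with w
      rw [BoundedFormula.realize_bdEqual, Sum.elim_comp_inl_inr, hp, hq, map_sub, sub_eq_zero]
    | rel R => exact R.elim isEmptyElim isEmptyElim
  | imp _ _ hφ hψ =>
    convert! hφ.compl_union hψ using 1
    ext w
    exact imp_iff_not_or

theorem exists_isQF_realize_iff {L : Language} {M α : Type*} [L.Structure M] {n : ℕ}
    {φ : L.BoundedFormula α n} (hφ : φ.IsExistential) :
    ∃ (m : ℕ) (h : n ≤ m) (ψ : L.BoundedFormula α m), ψ.IsQF ∧ ∀ (v : α → M) (xs : Fin n → M),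
      φ.Realize v xs ↔ ∃ ys : Fin m → M, ys ∘ Fin.castLE h = xs ∧ ψ.Realize v ys := by
  induction hφ with
  | of_isQF h => exact ⟨_, le_rfl, _, h, fun v xs ↦ by simp⟩
  | @ex n φ _ ih =>
    obtain ⟨m, h, ψ, hψ, hr⟩ := ih
    refine ⟨m, (Nat.le_succ n).trans h, ψ, hψ, fun v xs ↦ ?_⟩
    simp only [BoundedFormula.realize_ex, hr]
    constructor
    · rintro ⟨a, ys, hys, hψ⟩
      refine ⟨ys, funext fun i ↦ ?_, hψ⟩
      simpa using congr_fun hys i.castSucc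
    · rintro ⟨ys, rfl, hψ⟩
      refine ⟨ys (Fin.castLE h (Fin.last n)), ys, funext fun i ↦ ?_, hψ⟩
      refine Fin.lastCases ?_ (fun i ↦ ?_) i <;> simp

theorem exists_isGenericallyDecided_image_eq {K : Type*} [Field K] [Ring.CompatibleRing K]
    {A X : Set K} (hX : ExistentiallyDefinable₁ Language.ring A X) :
    ∃ (m : ℕ) (S : Set (Fin 1 ⊕ Fin m → K)),
      IsGenericallyDecided S ∧ (fun w ↦ w (.inl 0)) '' S = X := by
  obtain ⟨φ, hφ, rfl⟩ := hX
  obtain ⟨m, h, ψ, hψ, hr⟩ := exists_isQF_realize_iff (M := K) hφ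
  refine ⟨m, _, isGenericallyDecided_setOf_realize hψ, ?_⟩
  ext x
  simp only [Set.mem_image, Set.mem_ofPred_eq, Formula.Realize, hr]
  constructor
  · rintro ⟨w, hw, rfl⟩
    refine ⟨w ∘ Sum.inr, Subsingleton.elim _ _, ?_⟩
    convert! hw using 2 with i
    rw [Function.comp_apply, Subsingleton.elim i 0]
  · rintro ⟨ys, -, hys⟩
    exact ⟨Sum.elim (fun _ ↦ x) ys, hys, rfl⟩

end Definability

theorem exists_ideal_infinite_image_and_forall_finite_image {K σ α : Type*} [Field K] [Finite σ]
    {S : Set (σ → K)} {g : (σ → K) → α} (hS : (g '' S).Infinite) :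
    ∃ I : Ideal (MvPolynomial σ K), (g '' (S ∩ MvPolynomial.zeroLocus K I)).Infinite ∧
      ∀ f ∉ I, (g '' {w ∈ S ∩ MvPolynomial.zeroLocus K I | MvPolynomial.aeval w f = 0}).Finite := by
  obtain ⟨I, hI, hmax⟩ := (set_has_maximal_iff_noetherian (R := MvPolynomial σ K)).mpr
    inferInstance {I | (g '' (S ∩ MvPolynomial.zeroLocus K I)).Infinite} ⟨⊥, by simpa using hS⟩
  refine ⟨I, hI, fun f hf ↦ ?_⟩
  have hlt : I < I ⊔ Ideal.span {f} := by
    rwa [left_lt_sup, Ideal.span_singleton_le_iff_mem]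
  refine (Set.not_infinite.mp fun h ↦ hmax _ h hlt).subset (Set.image_mono ?_)
  rintro w ⟨⟨hwS, hwI⟩, hwf⟩
  have hle : I ⊔ Ideal.span {f} ≤ RingHom.ker (MvPolynomial.aeval w) :=
    sup_le hwI ((Ideal.span_singleton_le_iff_mem _).mpr hwf)
  exact ⟨hwS, hle⟩

/-- Among the closed sets on whose points in `S` the function `g` takes infinitely many values, a
minimal one is irreducible. -/
theorem exists_isPrime_forall_infinite_image {K σ α : Type*} [Field K] [Finite σ]
    {S : Set (σ → K)} {g : (σ → K) → α} (hS : (g '' S).Infinite) :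
    ∃ I : Ideal (MvPolynomial σ K), I.IsPrime ∧ ∀ f ∉ I,
      (g '' {w ∈ S ∩ MvPolynomial.zeroLocus K I | MvPolynomial.aeval w f ≠ 0}).Infinite := by
  obtain ⟨I, hI, hfin⟩ := exists_ideal_infinite_image_and_forall_finite_image hS
  have hinf : ∀ f ∉ I,
      (g '' {w ∈ S ∩ MvPolynomial.zeroLocus K I | MvPolynomial.aeval w f ≠ 0}).Infinite := by
    intro f hf h
    refine hI (((hfin f hf).union h).subset ?_)
    rw [← Set.image_union]
    exact Set.image_mono fun w hw ↦ (em _).imp (⟨hw, ·⟩) (⟨hw, ·⟩)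
  refine ⟨I, ⟨?_, fun {a b} hab ↦ ?_⟩, hinf⟩
  · rintro rfl
    simp at hI
  · by_contra! h
    refine hinf a h.1 ((hfin b h.2).subset (Set.image_mono fun w ⟨hw, hwa⟩ ↦ ⟨hw, ?_⟩))
    have hwab : MvPolynomial.aeval w a * MvPolynomial.aeval w b = 0 := by
      rw [← map_mul, hw.2 _ hab]
    exact (mul_eq_zero.mp hwab).resolve_left hwa

theorem transcendental_of_infinite_range {K A : Type*} [Field K] [CommRing A] [Algebra K A] {x : A}
    (hx : (Set.range fun Q : A →ₐ[K] K ↦ Q x).Infinite) : Transcendental K x := by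
  rintro ⟨p, hp0, hp⟩
  refine hx ((p.rootSet_finite K).subset (Set.range_subset_iff.mpr fun Q ↦ ?_))
  rw [mem_rootSet]
  exact ⟨hp0, by rw [aeval_algHom_apply, hp, map_zero]⟩

/-- The `K`-rational points of the closed subscheme of affine space cut out by `I` are the common
zeros of `I` in `K`. -/
noncomputable def zeroLocusEquiv {K σ : Type*} [Field K] (I : Ideal (MvPolynomial σ K)) :
    MvPolynomial.zeroLocus K I ≃ ((MvPolynomial σ K ⧸ I) →ₐ[K] K) where
  toFun w := Ideal.Quotient.liftₐ I (MvPolynomial.aeval w.1) (MvPolynomial.mem_zeroLocus_iff.mp w.2)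
  invFun Q := ⟨fun i ↦ Q (Ideal.Quotient.mk I (.X i)), fun p hp ↦ by
    have hQ : Q.comp (Ideal.Quotient.mkₐ K I) =
        MvPolynomial.aeval fun i ↦ Q (Ideal.Quotient.mk I (.X i)) :=
      MvPolynomial.aeval_unique _
    rw [← hQ, AlgHom.comp_apply, Ideal.Quotient.mkₐ_eq_mk, Ideal.Quotient.eq_zero_iff_mem.mpr hp,
      map_zero]⟩
  left_inv w := Subtype.ext <| funext fun i ↦
    (Ideal.Quotient.liftₐ_apply ..).trans (MvPolynomial.aeval_X ..)
  right_inv Q := Ideal.Quotient.algHom_ext _ <| MvPolynomial.algHom_ext fun i ↦ by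
    simp only [AlgHom.comp_apply, Ideal.Quotient.mkₐ_eq_mk]
    exact (Ideal.Quotient.liftₐ_apply ..).trans (MvPolynomial.aeval_X ..)

@[simp]
theorem zeroLocusEquiv_mk {K σ : Type*} [Field K] {I : Ideal (MvPolynomial σ K)}
    (w : MvPolynomial.zeroLocus K I) (p : MvPolynomial σ K) :
    zeroLocusEquiv I w (Ideal.Quotient.mk I p) = MvPolynomial.aeval w.1 p :=
  Ideal.Quotient.liftₐ_apply I _ (MvPolynomial.mem_zeroLocus_iff.mp w.2) _

theorem hasDenseRationalPoints_quotient {K σ : Type*} [Field K] {I : Ideal (MvPolynomial σ K)}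
    (hI : ∀ f ∉ I, ∃ w ∈ MvPolynomial.zeroLocus K I, MvPolynomial.aeval w f ≠ 0) :
    HasDenseRationalPoints K (MvPolynomial σ K ⧸ I) := by
  intro h hh
  obtain ⟨f, rfl⟩ := Ideal.Quotient.mk_surjective h
  obtain ⟨w, hw, hwf⟩ := hI f (Ideal.Quotient.eq_zero_iff_mem.not.mp hh)
  exact ⟨zeroLocusEquiv I ⟨w, hw⟩, by rwa [zeroLocusEquiv_mk]⟩

namespace IsAmpleField

variable {K : Type u} [Field K] [PerfectField K]

theorem closure_image_setOf_apply_ne_zero_eq_top (hK : IsAmpleField K) {D : Type u} [CommRing D]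
    [IsDomain D] [Algebra K D] [Algebra.FiniteType K D] (hD : HasDenseRationalPoints K D) {x : D}
    (hx : Transcendental K x) {f : D} (hf : f ≠ 0) :
    Subfield.closure ((fun Q : D →ₐ[K] K ↦ Q x) '' {Q | Q f ≠ 0}) = ⊤ := by
  let D' := Localization.Away f
  have hle : Submonoid.powers f ≤ nonZeroDivisors D :=
    powers_le_nonZeroDivisors_of_noZeroDivisors hf
  have : IsDomain D' := IsLocalization.isDomain_localization hle
  have : Algebra.FinitePresentation D D' := IsLocalization.Away.finitePresentation f
  have : Algebra.FiniteType K D' := .trans (S := D) inferInstance inferInstance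
  rw [eq_top_iff, ← hK.valueField_eq_top (hD.of_isLocalization_away hf (D' := D'))
    ((transcendental_algebraMap_iff (IsLocalization.injective D' hle)).mpr hx)]
  refine Subfield.closure_mono (Set.range_subset_iff.mpr fun Q ↦ ?_)
  refine ⟨Q.comp (IsScalarTower.toAlgHom K D D'), ?_, rfl⟩
  exact ((IsLocalization.Away.algebraMap_isUnit (S := D') f).map Q).ne_zero

theorem closure_image_eq_top (hK : IsAmpleField K) {σ : Type} [Finite σ] {S : Set (σ → K)}
    (hS : IsGenericallyDecided S) {i : σ} (hinf : ((fun w ↦ w i) '' S).Infinite) :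
    Subfield.closure ((fun w ↦ w i) '' S) = ⊤ := by
  obtain ⟨I, hI, hIinf⟩ := exists_isPrime_forall_infinite_image hinf
  obtain ⟨f, hf, hfS⟩ := hS I hI
  replace hfS := hfS.resolve_right fun h ↦ by
    obtain ⟨_, w, ⟨⟨hwS, hwI⟩, hwf⟩, -⟩ := (hIinf f hf).nonempty
    exact h ⟨hwI, hwf⟩ hwS
  have hD : HasDenseRationalPoints K (MvPolynomial σ K ⧸ I) := by
    refine hasDenseRationalPoints_quotient fun p hp ↦ ?_
    obtain ⟨_, w, ⟨⟨-, hwI⟩, hwp⟩, -⟩ := (hIinf p hp).nonempty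
    exact ⟨w, hwI, hwp⟩
  have hx : Transcendental K (Ideal.Quotient.mk I (.X i)) := by
    refine transcendental_of_infinite_range ((hIinf 1 hI.one_notMem).mono ?_)
    rintro _ ⟨w, ⟨⟨-, hwI⟩, -⟩, rfl⟩
    exact ⟨zeroLocusEquiv I ⟨w, hwI⟩, by simp⟩
  rw [eq_top_iff, ← hK.closure_image_setOf_apply_ne_zero_eq_top hD hx
    (Ideal.Quotient.eq_zero_iff_mem.not.mpr hf)]
  refine Subfield.closure_mono ?_
  rintro _ ⟨Q, hQ, rfl⟩
  obtain ⟨w, rfl⟩ := (zeroLocusEquiv I).surjective Q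
  simp only [Set.mem_ofPred_eq, zeroLocusEquiv_mk] at hQ
  exact ⟨w, hfS ⟨w.2, hQ⟩, by simp⟩

end IsAmpleField

theorem mainTheorem6_general (K : Type u) [Field K] [FirstOrder.Ring.CompatibleRing K]
    [PerfectField K] (hK : IsAmpleField K) {A X : Set K}
    (hX : ExistentiallyDefinable₁ FirstOrder.Language.ring A X) (hinf : X.Infinite) :
    Subfield.closure X = ⊤ := by
  obtain ⟨m, S, hS, rfl⟩ := exists_isGenericallyDecided_image_eq hX
  exact hK.closure_image_eq_top hS hinf

theorem mainTheorem6 (K : Type u) [Field K] [FirstOrder.Ring.CompatibleRing K] [PerfectField K]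
    (hK : IsAmpleField K) :
    ¬ ∃ F : Subfield K, F ≠ ⊤ ∧ Infinite F ∧
      ExistentiallyDefinable₁ FirstOrder.Language.ring (Set.univ : Set K) (F : Set K) := by
  rintro ⟨F, hne, hinf, hF⟩
  exact hne (F.closure_eq.symm.trans
    (mainTheorem6_general K hK hF (Set.infinite_coe_iff.mp hinf)))
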